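/- Let $d\ge 1$ be an integer, let $|x|$ denote the Euclidean norm on $\mathbb{R}^d$, and for real $s$ let $\Phi_{d,s}(x)=(1+|x|^2)^{(s-d)/2}$, $x\in\mathbb{R}^d$. For $-d<\alpha<d+2$ put $$\eta^{(1)}_{d,\alpha}=-\frac{\alpha\,2^{\alpha-1}\,\Gamma(\frac d2+\frac\alpha2)}{\Gamma(\frac d2-\frac\alpha2+1)},\qquad \eta^{(2)}_{d,\alpha}=\frac{2^{\alpha}\,\Gamma(\frac d2+\frac\alpha2+1)}{\Gamma(\frac d2-\frac\alpha2+1)}.$$ Then $$(-\Delta)^{\alpha/2}\,\Phi_{d,\alpha-2}=\eta^{(1)}_{d,\alpha}\,\Phi_{d,-\alpha}+\eta^{(2)}_{d,\alpha}\,\Phi_{d,-\alpha-2}$$ in both of the following senses. (i) For every $\alpha$ with $-d<\alpha<d+2$, in the Fourier sense: the Fourier transform $\mathcal F(\Phi_{d,\alpha-2})$, taken in the sense of tempered distributions, is a function, $|\omega|^{\alpha}\mathcal F(\Phi_{d,\alpha-2})(\omega)$ is a function that defines a tempered distribution, and the latter is the Fourier transform of the right-hand side, where $\omega$ is the angular frequency,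 i.e. $\mathcal F$ has the kernel $e^{-i\langle\omega,x\rangle}$. (For $\alpha\le 0$, $(-\Delta)^{\alpha/2}$ is thus the Fourier multiplier with symbol $|\omega|^\alpha$.) (ii) For every $0<\alpha<2$, also pointwise at every $x\in\mathbb{R}^d$, with the integral fractional Laplacian $$(-\Delta)^{\alpha/2}u(x)=c_{d,\alpha}\int_{\mathbb{R}^d}\frac{u(x)-u(y)}{|x-y|^{d+\alpha}}\,dy,\qquad c_{d,\alpha}=\frac{2^\alpha\,\Gamma(\frac{\alpha+d}{2})}{\pi^{d/2}\,|\Gamma(-\alpha/2)|},$$ where the integral converges absolutely if $\alpha<1$, and is a Cauchy principal value, i.e. $\lim_{\varepsilon\downarrow0}\int_{|x-y|>\varepsilon}$, if $\alpha\ge1$. -/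

import Mathlib

open MeasureTheory Filter Topology
open scoped FourierTransform SchwartzMap

noncomputable section

/-- The generalized multiquadric `Φ_{d,α}(x) = (1 + |x|²)^{α/2 - d/2}` on `ℝ^d`. -/
def gmq (d : ℕ) (α : ℝ) (x : EuclideanSpace ℝ (Fin d)) : ℝ :=
  (1 + ‖x‖ ^ 2) ^ (α / 2 - (d : ℝ) / 2)

/-- The normalizing constant
`c_{d,α} = 2^α Γ((α + d)/2) / (π^{d/2} |Γ(-α/2)|)` of the singular integral. -/
def fracLaplacianConst (d : ℕ) (α : ℝ) : ℝ :=
  2 ^ α * Real.Gamma ((α + d) / 2) / (Real.pi ^ ((d : ℝ) / 2) * |Real.Gamma (-α / 2)|)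

/-- The integrand `y ↦ (u(x) - u(y)) / |x - y|^{d+α}` of the singular integral at `x`. -/
def fracLaplacianIntegrand {d : ℕ} (α : ℝ) (u : EuclideanSpace ℝ (Fin d) → ℝ)
    (x y : EuclideanSpace ℝ (Fin d)) : ℝ :=
  (u x - u y) / ‖x - y‖ ^ ((d : ℝ) + α)

/-- The integral fractional Laplacian `(-Δ)^{α/2} u`, `0 < α < 2`, exists at the point `x` and has
the value `L`, that is,
`L = c_{d,α} ∫ (u(x) - u(y)) / |x - y|^{d+α} dy`.
For `α < 1` this is an absolutely convergent Lebesgue integral, and for `α ≥ 1` it is a Cauchy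
principal value: the limit, as `ε ↓ 0`, of the integrals over `{y : ε < |x - y|}`. -/
def HasIntegralFracLaplacianAt {d : ℕ} (α : ℝ) (u : EuclideanSpace ℝ (Fin d) → ℝ) (L : ℝ)
    (x : EuclideanSpace ℝ (Fin d)) : Prop :=
  (α < 1 →
    Integrable (fun y => fracLaplacianIntegrand α u x y) ∧
      fracLaplacianConst d α * ∫ y, fracLaplacianIntegrand α u x y = L) ∧
  (1 ≤ α →
    (∀ ε : ℝ, 0 < ε →
      IntegrableOn (fun y => fracLaplacianIntegrand α u x y) {y | ε < ‖x - y‖}) ∧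
      Tendsto
        (fun ε : ℝ => fracLaplacianConst d α *
          ∫ y in {y | ε < ‖x - y‖}, fracLaplacianIntegrand α u x y)
        (𝓝[>] 0) (𝓝 L))

/-- The Fourier transform of the function `u`, in the sense of tempered distributions, is the
function `g`: both pair absolutely with every Schwartz function, and
`∫ u 𝓕φ = ∫ g φ` for every Schwartz function `φ`. Here `𝓕φ(x) = ∫ e^{-2πi⟨w,x⟩} φ(w) dw`. -/
def HasTemperedFourier {d : ℕ} (u g : EuclideanSpace ℝ (Fin d) → ℂ) : Prop :=
  ∀ φ : 𝓢(EuclideanSpace ℝ (Fin d), ℂ),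
    Integrable (fun x => u x * (𝓕 φ) x) ∧
    Integrable (fun w => g w * φ w) ∧
    ∫ x, u x * (𝓕 φ) x = ∫ w, g w * φ w

/-- The function `v` is the fractional Laplacian `(-Δ)^{α/2} u` in the Fourier sense: the tempered
Fourier transform of `u` is a function `g`, and that of `v` is the symbol times `g`. With the
normalization `e^{-2πi⟨w,x⟩}` the frequency is `ω = 2πw`, so the symbol `|ω|^α` reads
`(2π|w|)^α`. -/
def HasFourierFracLaplacian {d : ℕ} (α : ℝ) (u v : EuclideanSpace ℝ (Fin d) → ℝ) : Prop :=
  ∃ g : EuclideanSpace ℝ (Fin d) → ℂ,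
    HasTemperedFourier (fun x => (u x : ℂ)) g ∧
    HasTemperedFourier (fun x => (v x : ℂ))
      (fun w => (((2 * Real.pi * ‖w‖) ^ α : ℝ) : ℂ) * g w)

/-- `η^{(1)}_{d,α} = - α 2^{α-1} Γ(d/2 + α/2) / Γ(d/2 - α/2 + 1)`. -/
def gmqEtaOne (d : ℕ) (α : ℝ) : ℝ :=
  -(α * 2 ^ (α - 1) * Real.Gamma ((d : ℝ) / 2 + α / 2) /
    Real.Gamma ((d : ℝ) / 2 - α / 2 + 1))

/-- `η^{(2)}_{d,α} = 2^α Γ(d/2 + α/2 + 1) / Γ(d/2 - α/2 + 1)`. -/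
def gmqEtaTwo (d : ℕ) (α : ℝ) : ℝ :=
  2 ^ α * Real.Gamma ((d : ℝ) / 2 + α / 2 + 1) / Real.Gamma ((d : ℝ) / 2 - α / 2 + 1)

end

/-!
The function `(1 + |x|²)^{-s}`, `s > 0`, is a Gamma mixture of Gaussians,
`Γ(s)⁻¹ ∫₀^∞ t^{s-1} e^{-t} e^{-t|x|²} dt`. Transforming the Gaussians under the integral sign shows
that it is, at every point, the inverse Fourier transform of the nonnegative integrable function
`besselDensity d s`, whose value at `w` is a constant times the Macdonald integral
`M p c = ∫₀^∞ t^{p-1} e^{-t - c/t} dt` at `p = s - d/2`, `c = π²|w|²`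
(`fourierInv_besselDensity`). Integrability is Tonelli's theorem: integrating the mixture in `w`
first leaves the Gamma integral. Duality then gives the tempered Fourier transform.

On the Fourier side the theorem is the three-term recurrence `M (p+1) c = p M p c + c M (p-1) c` at
`p = α/2`. The left-hand side has the index `p = 1 - α/2`, which the reflection
`M p c = c^p M (-p) c` turns into `α/2 - 1`, the power of `c` combining with the symbol
`(2π|w|)^α` into `2^α c`; the right-hand side has the indices `α/2` and `α/2 + 1`
(`rpow_mul_besselDensity`). The point `w = 0` is excluded and is a null set as `d ≥ 1`.

For `0 < α < 2` the singular integral is symmetrized: over a set symmetric under `h ↦ -h`, twice the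
integral of `(u(x) - u(x-h)) / |h|^{d+α}` is that of `(2u(x) - u(x+h) - u(x-h)) / |h|^{d+α}`.
By the inversion formula the second difference is
`∫ 2 g(w) cos(2π⟨w,x⟩) (1 - cos(2π⟨w,h⟩)) dw`, with `g` the density of `u`. As
`c_{d,α} ∫ (1 - cos(2π⟨w,h⟩)) / |h|^{d+α} dh = (2π|w|)^α` (`integrable_integral_one_sub_cos_div`),
and as `(2π|w|)^α g` is integrable by the identity on the Fourier side, Fubini's theorem applies;
it yields both the absolute convergence of the symmetrized integral and its value
(`integrable_integral_second_difference`). The principal value follows by dominated convergence.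
For `α < 1` the integral itself converges absolutely since `u` is bounded and Lipschitz.
-/

/-! ### The Macdonald integral and a Gamma-type integral -/

/-- The integral `∫₀^∞ t^{p-1} e^{-t - c/t} dt`, which for `c > 0` converges for every real `p` and
equals `2 c^{p/2} K_p(2√c)`, with `K_p` the modified Bessel function of the second kind. -/
noncomputable def macdonaldIntegral (p c : ℝ) : ℝ :=
  ∫ t in Set.Ioi (0 : ℝ), t ^ (p - 1) * Real.exp (-t - c / t)

/-- The factor `e^{-c/t}` vanishes at `t = 0` faster than any power `t ^ n`. -/
lemma exists_rpow_mul_exp_le (p : ℝ) {c : ℝ} (hc : 0 < c) :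
    ∃ C q : ℝ, 0 < q ∧ ∀ t : ℝ, 0 < t →
      t ^ p * Real.exp (-t - c / t) ≤ C * (Real.exp (-t) * t ^ q) := by
  -- From `(c/t)^n / n! ≤ e^{c/t}` with `n` so large that `p + n > 0`.
  obtain ⟨n, hn⟩ := exists_nat_gt (-p)
  refine ⟨n.factorial / c ^ n, p + n, by linarith, fun t ht => ?_⟩
  have h1 := Real.pow_div_factorial_le_exp (c / t) (by positivity) n
  have h2 : Real.exp (-(c / t)) ≤ n.factorial / c ^ n * t ^ n := by
    rw [Real.exp_neg]
    refine (inv_anti₀ (by positivity) h1).trans_eq ?_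
    rw [div_pow]
    field_simp
  rw [sub_eq_add_neg, Real.exp_add, Real.rpow_add ht, Real.rpow_natCast]
  calc t ^ p * (Real.exp (-t) * Real.exp (-(c / t)))
      ≤ t ^ p * (Real.exp (-t) * (n.factorial / c ^ n * t ^ n)) := by gcongr
    _ = _ := by ring

lemma integrableOn_macdonald (p : ℝ) {c : ℝ} (hc : 0 < c) :
    IntegrableOn (fun t : ℝ => t ^ (p - 1) * Real.exp (-t - c / t)) (Set.Ioi 0) := by
  obtain ⟨C, q, hq, h⟩ := exists_rpow_mul_exp_le (p - 1) hc
  have hG := (Real.GammaIntegral_convergent (s := q + 1) (by linarith)).const_mul C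
  refine Integrable.mono' hG (by fun_prop) ?_
  filter_upwards [ae_restrict_mem measurableSet_Ioi] with t ht
  have ht : 0 < t := ht
  rw [Real.norm_of_nonneg (by positivity), add_sub_cancel_right]
  exact h t ht

lemma macdonaldIntegral_symm (p : ℝ) {c : ℝ} (hc : 0 < c) :
    macdonaldIntegral p c = c ^ p * macdonaldIntegral (-p) c := by
  have h1 := integral_comp_rpow_Ioi
    (fun t : ℝ => t ^ (p - 1) * Real.exp (-t - c / t)) (p := -1) (by norm_num)
  have h2 := integral_comp_mul_left_Ioi
    (fun t : ℝ => t ^ (-p - 1) * Real.exp (-t - c / t)) 0 hc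
  rw [mul_zero] at h2
  unfold macdonaldIntegral
  have h3 : ∫ t in Set.Ioi (0 : ℝ), t ^ (-p - 1) * Real.exp (-t - c / t) =
      c * ∫ t in Set.Ioi (0 : ℝ), (c * t) ^ (-p - 1) * Real.exp (-(c * t) - c / (c * t)) := by
    rw [h2, smul_eq_mul, mul_inv_cancel_left₀ hc.ne']
  rw [← h1, h3, ← integral_const_mul, ← integral_const_mul]
  refine setIntegral_congr_fun measurableSet_Ioi fun t ht => ?_
  have ht : 0 < t := ht
  have e1 : t ^ (-1 : ℝ) = t⁻¹ := Real.rpow_neg_one t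
  have e2 : c ^ p * (c * c ^ (-p - 1)) = 1 := by
    nth_rewrite 2 [← Real.rpow_one c]
    rw [← Real.rpow_add hc, ← Real.rpow_add hc]; ring_nf; simp
  have e3 : t ^ (-1 - 1 : ℝ) * t⁻¹ ^ (p - 1) = t ^ (-p - 1) := by
    rw [Real.inv_rpow ht.le, ← Real.rpow_neg ht.le, ← Real.rpow_add ht]; ring_nf
  have e4 : -t⁻¹ - c / t⁻¹ = -(c * t) - c / (c * t) := by
    field_simp; ring
  simp only [e1, e4, smul_eq_mul, abs_neg, abs_one, one_mul]
  rw [← mul_assoc, e3, Real.mul_rpow hc.le ht.le]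
  linear_combination (-(t ^ (-p - 1) * Real.exp (-(c * t) - c / (c * t)))) * e2

/-- The three-term recurrence, from integrating the derivative of `t ^ p * e^{-t - c/t}`. -/
lemma macdonaldIntegral_add_one (p : ℝ) {c : ℝ} (hc : 0 < c) :
    macdonaldIntegral (p + 1) c = p * macdonaldIntegral p c + c * macdonaldIntegral (p - 1) c := by
  obtain ⟨C, q, hq, hb⟩ := exists_rpow_mul_exp_le p hc
  have hint0 := integrableOn_macdonald p hc
  have hint1 := integrableOn_macdonald (p + 1) hc
  have hint2 := integrableOn_macdonald (p - 1) hc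
  have hexp : ∀ t ∈ Set.Ioi (0 : ℝ), HasDerivAt (fun t : ℝ => Real.exp (-t - c / t))
      (Real.exp (-t - c / t) * (-1 + c / t ^ 2)) t := by
    intro t ht
    have ht : t ≠ 0 := ne_of_gt ht
    have h := ((hasDerivAt_id t).neg.sub ((hasDerivAt_inv ht).const_mul c)).exp
    convert! h using 1
    simp only [id, Pi.neg_apply, Pi.sub_apply]; field_simp; ring
  have hpow : ∀ t ∈ Set.Ioi (0 : ℝ), HasDerivAt (fun t : ℝ => t ^ p) (p * t ^ (p - 1)) t :=
    fun t ht => Real.hasDerivAt_rpow_const (Or.inl (ne_of_gt ht))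
  have key : Set.EqOn
      (fun t : ℝ => p * t ^ (p - 1) * Real.exp (-t - c / t) +
        t ^ p * (Real.exp (-t - c / t) * (-1 + c / t ^ 2)))
      (fun t : ℝ => p * (t ^ (p - 1) * Real.exp (-t - c / t)) -
        t ^ (p + 1 - 1) * Real.exp (-t - c / t) +
        c * (t ^ (p - 1 - 1) * Real.exp (-t - c / t))) (Set.Ioi 0) := by
    intro t ht
    have ht : 0 < t := ht
    have e : t ^ (p - 1 - 1) = t ^ p / t ^ 2 := by
      rw [Real.rpow_sub_one ht.ne', Real.rpow_sub_one ht.ne']; field_simp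
    simp only [e, add_sub_cancel_right]
    ring
  have hS : IntegrableOn (fun t : ℝ => p * (t ^ (p - 1) * Real.exp (-t - c / t)) -
      t ^ (p + 1 - 1) * Real.exp (-t - c / t)) (Set.Ioi 0) := (hint0.const_mul p).sub hint1
  have hI : IntegrableOn (fun t : ℝ => p * (t ^ (p - 1) * Real.exp (-t - c / t)) -
      t ^ (p + 1 - 1) * Real.exp (-t - c / t) +
      c * (t ^ (p - 1 - 1) * Real.exp (-t - c / t))) (Set.Ioi 0) := hS.add (hint2.const_mul c)
  have hnn : ∀ t ∈ Set.Ioi (0 : ℝ), 0 ≤ t ^ p * Real.exp (-t - c / t) := fun t ht => by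
    have ht : 0 < t := ht
    positivity
  have h0 : Tendsto (fun t : ℝ => C * (Real.exp (-t) * t ^ q)) (𝓝[>] 0) (𝓝 0) := by
    have : ContinuousAt (fun t : ℝ => C * (Real.exp (-t) * t ^ q)) 0 := by
      have := Real.continuousAt_rpow_const 0 q (Or.inr hq.le)
      fun_prop
    have := this.tendsto
    rw [Real.zero_rpow hq.ne', mul_zero, mul_zero] at this
    exact this.mono_left nhdsWithin_le_nhds
  have h1 : Tendsto (fun t : ℝ => C * (Real.exp (-t) * t ^ q)) atTop (𝓝 0) := by
    have := (tendsto_rpow_mul_exp_neg_mul_atTop_nhds_zero q 1 one_pos).const_mul C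
    simpa [mul_comm] using this
  have hFTC := integral_Ioi_deriv_mul_eq_sub hpow hexp
    (hI.congr_fun key.symm measurableSet_Ioi)
    (squeeze_zero' (eventually_mem_nhdsWithin.mono hnn)
      (eventually_mem_nhdsWithin.mono hb) h0)
    (squeeze_zero' ((eventually_gt_atTop 0).mono hnn) ((eventually_gt_atTop 0).mono hb) h1)
  rw [setIntegral_congr_fun measurableSet_Ioi key, sub_zero,
    integral_add hS (hint2.const_mul c),
    integral_sub (hint0.const_mul p) hint1, integral_const_mul, integral_const_mul] at hFTC
  unfold macdonaldIntegral
  linarith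

lemma integrableOn_integral_rpow_mul_exp_neg_div {a c : ℝ} (ha : a < 1) (hc : 0 < c) :
    IntegrableOn (fun t : ℝ => t ^ (a - 2) * Real.exp (-(c / t))) (Set.Ioi 0) ∧
      ∫ t in Set.Ioi (0 : ℝ), t ^ (a - 2) * Real.exp (-(c / t)) =
        c ^ (a - 1) * Real.Gamma (1 - a) := by
  have hkey : Set.EqOn
      (fun t : ℝ => (|(-1 : ℝ)| * t ^ ((-1 : ℝ) - 1)) •
        ((t ^ (-1 : ℝ)) ^ (1 - a - 1) * Real.exp (-(c * t ^ (-1 : ℝ)))))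
      (fun t : ℝ => t ^ (a - 2) * Real.exp (-(c / t))) (Set.Ioi 0) := by
    intro t ht
    have ht : 0 < t := ht
    have e : t ^ (-1 - 1 : ℝ) * (t ^ (-1 : ℝ)) ^ (1 - a - 1) = t ^ (a - 2) := by
      rw [← Real.rpow_mul ht.le, ← Real.rpow_add ht]; ring_nf
    simp only [smul_eq_mul, abs_neg, abs_one, one_mul]
    rw [← mul_assoc, e, Real.rpow_neg_one, div_eq_mul_inv]
  constructor
  · have h : IntegrableOn (fun t : ℝ => t ^ (1 - a - 1) * Real.exp (-(c * t))) (Set.Ioi 0) := by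
      have := integrableOn_rpow_mul_exp_neg_mul_rpow (p := 1) (s := 1 - a - 1) (b := c)
        (by linarith) one_pos hc
      simpa using this
    exact ((integrableOn_Ioi_comp_rpow_iff _ (p := -1) (by norm_num)).2 h).congr_fun hkey
      measurableSet_Ioi
  · have h := integral_comp_rpow_Ioi
      (fun t : ℝ => t ^ (1 - a - 1) * Real.exp (-(c * t))) (p := -1) (by norm_num)
    rw [Real.integral_rpow_mul_exp_neg_mul_Ioi (by linarith) hc,
      setIntegral_congr_fun measurableSet_Ioi hkey] at h
    rw [h, one_div, Real.inv_rpow hc.le, ← Real.rpow_neg hc.le, neg_sub]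

/-- Integration by parts against `t ^ a / a` reduces the integral to a Gamma integral. -/
lemma integrableOn_integral_rpow_mul_one_sub_exp {a c : ℝ} (ha : 0 < a) (ha1 : a < 1)
    (hc : 0 < c) :
    IntegrableOn (fun t : ℝ => t ^ (a - 1) * (1 - Real.exp (-(c / t)))) (Set.Ioi 0) ∧
      ∫ t in Set.Ioi (0 : ℝ), t ^ (a - 1) * (1 - Real.exp (-(c / t))) =
        c ^ a * Real.Gamma (1 - a) / a := by
  obtain ⟨hI, hV⟩ := integrableOn_integral_rpow_mul_exp_neg_div ha1 hc
  have hle : ∀ t ∈ Set.Ioi (0 : ℝ), 0 ≤ 1 - Real.exp (-(c / t)) ∧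
      1 - Real.exp (-(c / t)) ≤ 1 ∧ 1 - Real.exp (-(c / t)) ≤ c / t := by
    intro t ht
    have ht : 0 < t := ht
    have hct : 0 < c / t := by positivity
    refine ⟨by simpa using hct.le, by simpa using (Real.exp_pos _).le, ?_⟩
    have := Real.add_one_le_exp (-(c / t))
    linarith
  have hJ : IntegrableOn (fun t : ℝ => t ^ (a - 1) * (1 - Real.exp (-(c / t)))) (Set.Ioi 0) := by
    rw [← Set.Ioc_union_Ioi_eq_Ioi zero_le_one]
    have hm : Measurable (fun t : ℝ => t ^ (a - 1) * (1 - Real.exp (-(c / t)))) := by fun_prop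
    refine IntegrableOn.union ?_ ?_
    · have h1 : IntegrableOn (fun t : ℝ => t ^ (a - 1)) (Set.Ioc 0 1) :=
        (intervalIntegrable_iff_integrableOn_Ioc_of_le zero_le_one).1
          (intervalIntegral.intervalIntegrable_rpow' (by linarith))
      refine Integrable.mono' h1 hm.aestronglyMeasurable ?_
      filter_upwards [ae_restrict_mem measurableSet_Ioc] with t ht
      have ht0 : 0 < t := ht.1
      obtain ⟨h1, h2, -⟩ := hle t ht0
      rw [Real.norm_of_nonneg (by positivity)]
      exact mul_le_of_le_one_right (by positivity) h2
    · have h1 := (integrableOn_Ioi_rpow_of_lt (a := a - 2) (by linarith) one_pos).const_mul c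
      refine Integrable.mono' h1 hm.aestronglyMeasurable ?_
      filter_upwards [ae_restrict_mem measurableSet_Ioi] with t ht
      have ht0 : 0 < t := lt_trans one_pos ht
      obtain ⟨h1, -, h2⟩ := hle t ht0
      rw [Real.norm_of_nonneg (by positivity)]
      have e : c * t ^ (a - 2) = t ^ (a - 1) * (c / t) := by
        rw [show a - 2 = a - 1 - 1 by ring, Real.rpow_sub_one ht0.ne' (a - 1)]; ring
      rw [e]
      gcongr
  refine ⟨hJ, ?_⟩
  have hpow : ∀ t ∈ Set.Ioi (0 : ℝ), HasDerivAt (fun t : ℝ => t ^ a / a) (t ^ (a - 1)) t := by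
    intro t ht
    have := (Real.hasDerivAt_rpow_const (p := a) (Or.inl (ne_of_gt ht))).div_const a
    rwa [mul_div_cancel_left₀ _ ha.ne'] at this
  have hexp : ∀ t ∈ Set.Ioi (0 : ℝ), HasDerivAt (fun t : ℝ => 1 - Real.exp (-(c / t)))
      (-(c / t ^ 2 * Real.exp (-(c / t)))) t := by
    intro t ht
    have ht : t ≠ 0 := ne_of_gt ht
    have h := (((hasDerivAt_inv ht).const_mul c).neg.exp).const_sub 1
    convert! h using 1
    simp only [Pi.neg_apply]; field_simp
  have key : Set.EqOn (fun t : ℝ => t ^ (a - 1) * (1 - Real.exp (-(c / t))) +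
        t ^ a / a * (-(c / t ^ 2 * Real.exp (-(c / t)))))
      (fun t : ℝ => t ^ (a - 1) * (1 - Real.exp (-(c / t))) -
        c / a * (t ^ (a - 2) * Real.exp (-(c / t)))) (Set.Ioi 0) := by
    intro t ht
    have ht : 0 < t := ht
    have e : t ^ (a - 2) = t ^ a / t ^ 2 := by
      rw [Real.rpow_sub ht, Real.rpow_two]
    simp only [e]
    ring
  have hnn : ∀ t ∈ Set.Ioi (0 : ℝ), 0 ≤ t ^ a / a * (1 - Real.exp (-(c / t))) := fun t ht => by
    have ht0 : 0 < t := ht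
    have := (hle t ht).1
    positivity
  have h0 : Tendsto (fun t : ℝ => t ^ a / a) (𝓝[>] 0) (𝓝 0) := by
    have := ((Real.continuousAt_rpow_const 0 a (Or.inr ha.le)).div_const a).tendsto
    rw [Real.zero_rpow ha.ne', zero_div] at this
    exact this.mono_left nhdsWithin_le_nhds
  have h1 : Tendsto (fun t : ℝ => c / a * t ^ (-(1 - a))) atTop (𝓝 0) := by
    simpa using (tendsto_rpow_neg_atTop (y := 1 - a) (by linarith)).const_mul (c / a)
  have hFTC := integral_Ioi_deriv_mul_eq_sub hpow hexp
    ((hJ.sub (hI.const_mul (c / a))).congr_fun key.symm measurableSet_Ioi)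
    (squeeze_zero' (eventually_mem_nhdsWithin.mono hnn)
      (eventually_mem_nhdsWithin.mono fun t ht => by
        have ht0 : 0 < t := ht
        exact mul_le_of_le_one_right (by positivity) (hle t ht).2.1) h0)
    (squeeze_zero' ((eventually_gt_atTop 0).mono hnn) ((eventually_gt_atTop 0).mono fun t ht => by
      have ht0 : 0 < t := ht
      have e : c / a * t ^ (-(1 - a)) = t ^ a / a * (c / t) := by
        rw [neg_sub, Real.rpow_sub_one ht0.ne' a]; ring
      rw [e]
      exact mul_le_mul_of_nonneg_left (hle t ht).2.2 (by positivity)) h1)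
  rw [setIntegral_congr_fun measurableSet_Ioi key, sub_zero,
    integral_sub hJ (hI.const_mul (c / a)), integral_const_mul, hV,
    Real.rpow_sub_one hc.ne' a] at hFTC
  rw [sub_eq_zero.1 hFTC]
  field_simp

/-! ### The Fourier transform of an inverse multiquadric -/

/-- The Fourier transform of `x ↦ (1 + |x|²)^{-s}` on `ℝ^d`, in the normalization
`e^{-2πi⟨w,x⟩}`. The value at `w = 0` is meaningless when `s ≤ d / 2`, where the integral
diverges. -/
noncomputable def besselDensity (d : ℕ) (s : ℝ) (w : EuclideanSpace ℝ (Fin d)) : ℝ :=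
  Real.pi ^ ((d : ℝ) / 2) / Real.Gamma s *
    macdonaldIntegral (s - (d : ℝ) / 2) (Real.pi ^ 2 * ‖w‖ ^ 2)

/-- The Gaussian `e^{-t|x|²}` has Fourier transform `(π/t)^{d/2} e^{-π²|w|²/t}`; this is the latter
multiplied by the density `t^{s-1} e^{-t}` of the Gamma distribution. -/
noncomputable def gammaGaussianKernel (d : ℕ) (s : ℝ) (t : ℝ)
    (w : EuclideanSpace ℝ (Fin d)) : ℝ :=
  t ^ (s - 1) * Real.exp (-t) *
    ((Real.pi / t) ^ ((d : ℝ) / 2) * Real.exp (-(Real.pi ^ 2 / t) * ‖w‖ ^ 2))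

lemma gammaGaussianKernel_nonneg (d : ℕ) (s : ℝ) {t : ℝ} (ht : 0 < t)
    (w : EuclideanSpace ℝ (Fin d)) : 0 ≤ gammaGaussianKernel d s t w := by
  have := Real.pi_pos
  unfold gammaGaussianKernel
  positivity

lemma integral_gammaGaussianKernel_left (d : ℕ) (s : ℝ) (w : EuclideanSpace ℝ (Fin d)) :
    ∫ t in Set.Ioi (0 : ℝ), gammaGaussianKernel d s t w =
      Real.pi ^ ((d : ℝ) / 2) *
        macdonaldIntegral (s - (d : ℝ) / 2) (Real.pi ^ 2 * ‖w‖ ^ 2) := by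
  unfold macdonaldIntegral
  rw [← integral_const_mul]
  refine setIntegral_congr_fun measurableSet_Ioi fun t ht => ?_
  have ht : 0 < t := ht
  have hpi := Real.pi_pos
  have e1 : t ^ (s - (d : ℝ) / 2 - 1) = t ^ (s - 1) / t ^ ((d : ℝ) / 2) := by
    rw [← Real.rpow_sub ht]; ring_nf
  have e2 : Real.exp (-t - Real.pi ^ 2 * ‖w‖ ^ 2 / t) =
      Real.exp (-t) * Real.exp (-(Real.pi ^ 2 / t) * ‖w‖ ^ 2) := by
    rw [← Real.exp_add]; ring_nf
  simp only [gammaGaussianKernel]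
  rw [e1, e2, Real.div_rpow hpi.le ht.le]
  ring

lemma besselDensity_eq_integral (d : ℕ) (s : ℝ) (w : EuclideanSpace ℝ (Fin d)) :
    besselDensity d s w =
      (Real.Gamma s)⁻¹ * ∫ t in Set.Ioi (0 : ℝ), gammaGaussianKernel d s t w := by
  rw [integral_gammaGaussianKernel_left, besselDensity]; ring

lemma besselDensity_nonneg (d : ℕ) {s : ℝ} (hs : 0 < s) (w : EuclideanSpace ℝ (Fin d)) :
    0 ≤ besselDensity d s w := by
  rw [besselDensity_eq_integral]
  exact mul_nonneg (inv_nonneg.2 (Real.Gamma_pos_of_pos hs).le)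
    (setIntegral_nonneg measurableSet_Ioi fun t ht => gammaGaussianKernel_nonneg d s ht w)

lemma integrable_gammaGaussianKernel_right (d : ℕ) (s : ℝ) {t : ℝ} (ht : 0 < t) :
    Integrable (gammaGaussianKernel d s t) := by
  have hb : 0 < (((Real.pi ^ 2 / t : ℝ) : ℂ)).re := by
    have := Real.pi_pos
    rw [Complex.ofReal_re]; positivity
  have h := GaussianFourier.integrable_cexp_neg_mul_sq_norm_add hb 0
    (0 : EuclideanSpace ℝ (Fin d))
  have h2 := h.re
  refine ((h2.const_mul ((Real.pi / t) ^ ((d : ℝ) / 2))).const_mul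
    (t ^ (s - 1) * Real.exp (-t))).congr (Eventually.of_forall fun w => ?_)
  simp only [gammaGaussianKernel, zero_mul, add_zero]
  congr 2
  rw [← Complex.ofReal_pow, ← Complex.ofReal_neg, ← Complex.ofReal_mul, ← Complex.ofReal_exp]
  exact Complex.ofReal_re _

lemma integral_gammaGaussianKernel_right (d : ℕ) (s : ℝ) {t : ℝ} (ht : 0 < t) :
    ∫ w, gammaGaussianKernel d s t w = t ^ (s - 1) * Real.exp (-t) := by
  have hpi := Real.pi_pos
  have hb : 0 < Real.pi ^ 2 / t := by positivity
  simp only [gammaGaussianKernel]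
  rw [integral_const_mul, integral_const_mul, GaussianFourier.integral_rexp_neg_mul_sq_norm hb,
    finrank_euclideanSpace_fin, ← Real.mul_rpow (by positivity) (by positivity)]
  have : Real.pi / t * (Real.pi / (Real.pi ^ 2 / t)) = 1 := by field_simp
  rw [this, Real.one_rpow, mul_one]

lemma integrable_gammaGaussianKernel (d : ℕ) {s : ℝ} (hs : 0 < s) :
    Integrable (Function.uncurry (gammaGaussianKernel d s))
      ((volume.restrict (Set.Ioi 0)).prod volume) := by
  have hm : AEStronglyMeasurable (Function.uncurry (gammaGaussianKernel d s))
      ((volume.restrict (Set.Ioi 0)).prod volume) := by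
    unfold gammaGaussianKernel Function.uncurry
    fun_prop
  rw [integrable_prod_iff hm]
  constructor
  · filter_upwards [ae_restrict_mem measurableSet_Ioi] with t ht
    exact integrable_gammaGaussianKernel_right d s ht
  · refine (Real.GammaIntegral_convergent hs).congr ?_
    filter_upwards [ae_restrict_mem measurableSet_Ioi] with t ht
    simp only [Function.uncurry, Real.norm_of_nonneg (gammaGaussianKernel_nonneg d s ht _)]
    rw [integral_gammaGaussianKernel_right d s ht, mul_comm]

lemma integrable_besselDensity (d : ℕ) {s : ℝ} (hs : 0 < s) : Integrable (besselDensity d s) := by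
  have h := (integrable_gammaGaussianKernel d hs).integral_prod_right.const_mul (Real.Gamma s)⁻¹
  exact h.congr (Eventually.of_forall fun w => (besselDensity_eq_integral d s w).symm)

lemma integral_cexp_mul_gammaGaussianKernel (d : ℕ) (s : ℝ) {t : ℝ} (ht : 0 < t)
    (x : EuclideanSpace ℝ (Fin d)) :
    ∫ w, Complex.exp ((2 * Real.pi * inner ℝ w x : ℝ) * Complex.I) *
      (gammaGaussianKernel d s t w : ℂ) =
      ((t ^ (s - 1) * Real.exp (-((1 + ‖x‖ ^ 2) * t)) : ℝ) : ℂ) := by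
  have hpi := Real.pi_pos
  have hb : 0 < (((Real.pi ^ 2 / t : ℝ) : ℂ)).re := by
    rw [Complex.ofReal_re]; positivity
  have h := GaussianFourier.integral_cexp_neg_mul_sq_norm_add hb (2 * Real.pi * Complex.I) x
  have e : ∀ w : EuclideanSpace ℝ (Fin d),
      Complex.exp ((2 * Real.pi * inner ℝ w x : ℝ) * Complex.I) *
        (gammaGaussianKernel d s t w : ℂ) =
      ((t ^ (s - 1) * Real.exp (-t) * (Real.pi / t) ^ ((d : ℝ) / 2) : ℝ) : ℂ) *
        Complex.exp (-((Real.pi ^ 2 / t : ℝ) : ℂ) * ‖w‖ ^ 2 +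
          2 * Real.pi * Complex.I * (inner ℝ x w : ℝ)) := by
    intro w
    rw [gammaGaussianKernel, Complex.exp_add, real_inner_comm w x]
    push_cast
    ring_nf
  simp_rw [e]
  rw [integral_const_mul, h, finrank_euclideanSpace_fin]
  have e2 : ((Real.pi : ℂ) / ((Real.pi ^ 2 / t : ℝ) : ℂ)) ^ ((d : ℂ) / 2) =
      (((t / Real.pi) ^ ((d : ℝ) / 2) : ℝ) : ℂ) := by
    rw [Complex.ofReal_cpow (by positivity)]
    push_cast
    congr 1
    have : (Real.pi : ℂ) ≠ 0 := by exact_mod_cast hpi.ne'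
    have : (t : ℂ) ≠ 0 := by exact_mod_cast ht.ne'
    field_simp
  have e3 : (2 * Real.pi * Complex.I) ^ 2 * (‖x‖ : ℂ) ^ 2 / (4 * ((Real.pi ^ 2 / t : ℝ) : ℂ)) =
      ((-(t * ‖x‖ ^ 2) : ℝ) : ℂ) := by
    have : (Real.pi : ℂ) ≠ 0 := by exact_mod_cast hpi.ne'
    have : (t : ℂ) ≠ 0 := by exact_mod_cast ht.ne'
    push_cast
    field_simp
    rw [Complex.I_sq]
    ring
  rw [e2, e3, ← Complex.ofReal_exp, ← Complex.ofReal_mul, ← Complex.ofReal_mul]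
  congr 1
  have e4 : (Real.pi / t) ^ ((d : ℝ) / 2) * (t / Real.pi) ^ ((d : ℝ) / 2) = 1 := by
    rw [← Real.mul_rpow (by positivity) (by positivity)]
    have : Real.pi / t * (t / Real.pi) = 1 := by field_simp
    rw [this, Real.one_rpow]
  have e5 : Real.exp (-((1 + ‖x‖ ^ 2) * t)) = Real.exp (-t) * Real.exp (-(t * ‖x‖ ^ 2)) := by
    rw [← Real.exp_add]; ring_nf
  rw [e5]
  linear_combination (t ^ (s - 1) * Real.exp (-t) * Real.exp (-(t * ‖x‖ ^ 2))) * e4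

/-- The Gamma mixture of the Gaussian Fourier pairs: `(1 + |x|²)^{-s}` is, at every point, the
inverse Fourier transform of the integrable function `besselDensity d s`. -/
lemma fourierInv_besselDensity (d : ℕ) {s : ℝ} (hs : 0 < s) (x : EuclideanSpace ℝ (Fin d)) :
    𝓕⁻ (fun w => (besselDensity d s w : ℂ)) x = (((1 + ‖x‖ ^ 2) ^ (-s) : ℝ) : ℂ) := by
  have hG := Real.Gamma_pos_of_pos hs
  have hk := (integrable_gammaGaussianKernel d hs).ofReal (𝕜 := ℂ)
  have hprod : Integrable (Function.uncurry fun (t : ℝ) (w : EuclideanSpace ℝ (Fin d)) =>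
      Complex.exp ((2 * Real.pi * inner ℝ w x : ℝ) * Complex.I) *
        (gammaGaussianKernel d s t w : ℂ)) ((volume.restrict (Set.Ioi 0)).prod volume) := by
    refine hk.bdd_mul (c := 1) ?_ (Eventually.of_forall fun z => ?_)
    · fun_prop
    · rw [Complex.norm_exp_ofReal_mul_I]
  rw [Real.fourierInv_eq']
  calc ∫ w, Complex.exp ((2 * Real.pi * inner ℝ w x : ℝ) * Complex.I) • (besselDensity d s w : ℂ)
      = ((Real.Gamma s)⁻¹ : ℂ) * ∫ w, ∫ t in Set.Ioi (0 : ℝ),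
          Complex.exp ((2 * Real.pi * inner ℝ w x : ℝ) * Complex.I) *
            (gammaGaussianKernel d s t w : ℂ) := by
        rw [← integral_const_mul]
        refine integral_congr_ae (Eventually.of_forall fun w => ?_)
        simp only [smul_eq_mul]
        rw [integral_const_mul, besselDensity_eq_integral, integral_complex_ofReal]
        push_cast
        ring
    _ = ((Real.Gamma s)⁻¹ : ℂ) * ∫ t in Set.Ioi (0 : ℝ),
          ((t ^ (s - 1) * Real.exp (-((1 + ‖x‖ ^ 2) * t)) : ℝ) : ℂ) := by
        rw [← integral_integral_swap hprod]
        congr 1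
        exact setIntegral_congr_fun measurableSet_Ioi fun t ht =>
          integral_cexp_mul_gammaGaussianKernel d s ht x
    _ = _ := by
        rw [integral_complex_ofReal,
          Real.integral_rpow_mul_exp_neg_mul_Ioi hs (by positivity : 0 < 1 + ‖x‖ ^ 2),
          ← Complex.ofReal_inv, ← Complex.ofReal_mul]
        congr 1
        rw [one_div, Real.inv_rpow (by positivity), Real.rpow_neg (by positivity)]
        field_simp

/-- The real part of the inversion formula. -/
lemma integral_besselDensity_mul_cos (d : ℕ) {s : ℝ} (hs : 0 < s)
    (x : EuclideanSpace ℝ (Fin d)) :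
    ∫ w, besselDensity d s w * Real.cos (2 * Real.pi * inner ℝ w x) = (1 + ‖x‖ ^ 2) ^ (-s) := by
  have h := fourierInv_besselDensity d hs x
  rw [Real.fourierInv_eq'] at h
  have hint : Integrable (fun w : EuclideanSpace ℝ (Fin d) =>
      Complex.exp ((2 * Real.pi * inner ℝ w x : ℝ) * Complex.I) • (besselDensity d s w : ℂ)) := by
    refine (integrable_besselDensity d hs).ofReal.bdd_mul (c := 1) (by fun_prop)
      (Eventually.of_forall fun z => ?_)
    rw [Complex.norm_exp_ofReal_mul_I]
  have h2 := congrArg Complex.re h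
  rw [Complex.ofReal_re, ← RCLike.re_eq_complex_re, ← integral_re hint] at h2
  rw [← h2]
  refine integral_congr_ae (Eventually.of_forall fun w => ?_)
  simp only [RCLike.re_eq_complex_re, smul_eq_mul, Complex.re_mul_ofReal,
    Complex.exp_ofReal_mul_I_re]
  ring

/-- An integrable function is the tempered Fourier transform of its inverse Fourier transform. -/
lemma hasTemperedFourier_of_fourierInv_eq {d : ℕ} {u g : EuclideanSpace ℝ (Fin d) → ℂ}
    (hg : Integrable g) (h : ∀ x, 𝓕⁻ g x = u x) : HasTemperedFourier u g := by
  intro φ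
  have hu : u = 𝓕⁻ g := funext fun x => (h x).symm
  have hcont : Continuous u := by
    rw [hu]
    exact VectorFourier.fourierIntegral_continuous Real.continuous_fourierChar
      (by simpa using! continuous_inner.neg) hg
  have hbdd : ∀ x, ‖u x‖ ≤ ∫ w, ‖g w‖ := fun x => by
    rw [hu]
    exact VectorFourier.norm_fourierIntegral_le_integral_norm _ _ _ _ _
  obtain ⟨C, hC⟩ := φ.decay 0 0
  refine ⟨(𝓕 φ).integrable.bdd_mul hcont.aestronglyMeasurable (Eventually.of_forall hbdd),
    hg.mul_bdd φ.continuous.aestronglyMeasurable (c := C) (Eventually.of_forall fun x => by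
      simpa using hC.2 x), ?_⟩
  have hflip := VectorFourier.integral_fourierIntegral_smul_eq_flip (e := 𝐞)
    (L := -innerₗ (EuclideanSpace ℝ (Fin d))) (μ := volume) (ν := volume) (f := g)
    (g := fun x => (𝓕 φ) x) Real.continuous_fourierChar
    (by simpa using! continuous_inner.neg) hg (𝓕 φ).integrable
  have e : ∀ w, VectorFourier.fourierIntegral 𝐞 volume
      (-innerₗ (EuclideanSpace ℝ (Fin d))).flip (fun x => (𝓕 φ) x) w = φ w := by
    intro w
    have h1 : (-innerₗ (EuclideanSpace ℝ (Fin d))).flip = -innerₗ (EuclideanSpace ℝ (Fin d)) := by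
      ext a b
      simp [real_inner_comm]
    rw [h1]
    change 𝓕⁻ (⇑(𝓕 φ : 𝓢(EuclideanSpace ℝ (Fin d), ℂ))) w = φ w
    rw [← SchwartzMap.fourierInv_coe, FourierTransform.fourierInv_fourier_eq]
  simp only [e, smul_eq_mul] at hflip
  rw [hu]
  exact hflip

/-! ### The identity on the Fourier side -/

lemma gmq_eq_rpow (d : ℕ) (β : ℝ) (x : EuclideanSpace ℝ (Fin d)) :
    gmq d β x = (1 + ‖x‖ ^ 2) ^ (-(((d : ℝ) - β) / 2)) := by
  rw [gmq]; ring_nf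

lemma hasTemperedFourier_gmq (d : ℕ) {β : ℝ} (hβ : β < d) :
    HasTemperedFourier (fun x => (gmq d β x : ℂ))
      (fun w => (besselDensity d (((d : ℝ) - β) / 2) w : ℂ)) := by
  have hs : 0 < ((d : ℝ) - β) / 2 := by linarith
  refine hasTemperedFourier_of_fourierInv_eq (integrable_besselDensity d hs).ofReal fun x => ?_
  rw [fourierInv_besselDensity d hs, gmq_eq_rpow]

lemma HasTemperedFourier.const_mul_add_const_mul {d : ℕ}
    {u₁ g₁ u₂ g₂ : EuclideanSpace ℝ (Fin d) → ℂ} (h₁ : HasTemperedFourier u₁ g₁)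
    (h₂ : HasTemperedFourier u₂ g₂) (a b : ℂ) :
    HasTemperedFourier (fun x => a * u₁ x + b * u₂ x) (fun w => a * g₁ w + b * g₂ w) := by
  intro φ
  obtain ⟨hu₁, hg₁, h₁⟩ := h₁ φ
  obtain ⟨hu₂, hg₂, h₂⟩ := h₂ φ
  simp only [add_mul, mul_assoc]
  refine ⟨(hu₁.const_mul a).add (hu₂.const_mul b), (hg₁.const_mul a).add (hg₂.const_mul b), ?_⟩
  rw [integral_add (hu₁.const_mul a) (hu₂.const_mul b),
    integral_add (hg₁.const_mul a) (hg₂.const_mul b)]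
  simp only [integral_const_mul, h₁, h₂]

lemma HasTemperedFourier.congr_ae {d : ℕ} {u g g' : EuclideanSpace ℝ (Fin d) → ℂ}
    (h : HasTemperedFourier u g) (hg : g =ᵐ[volume] g') : HasTemperedFourier u g' := by
  intro φ
  obtain ⟨h1, h2, h3⟩ := h φ
  have e : (fun w => g w * φ w) =ᵐ[volume] fun w => g' w * φ w := by
    filter_upwards [hg] with w hw
    rw [hw]
  exact ⟨h1, h2.congr e, h3.trans (integral_congr_ae e)⟩

/-- The identity on the Fourier side: reflection `p ↦ -p` of the Macdonald integral turns the
density on the left into one of index `α / 2 - 1`, and the three-term recurrence splits it. -/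
lemma rpow_mul_besselDensity {d : ℕ} {α : ℝ} (hα_lower : -(d : ℝ) < α)
    {w : EuclideanSpace ℝ (Fin d)} (hw : w ≠ 0) :
    (2 * Real.pi * ‖w‖) ^ α * besselDensity d (((d : ℝ) - (α - 2)) / 2) w =
      gmqEtaOne d α * besselDensity d (((d : ℝ) - -α) / 2) w +
        gmqEtaTwo d α * besselDensity d (((d : ℝ) - (-α - 2)) / 2) w := by
  have hpi := Real.pi_pos
  have hw' : 0 < ‖w‖ := norm_pos_iff.2 hw
  have hc : 0 < Real.pi ^ 2 * ‖w‖ ^ 2 := by positivity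
  simp only [besselDensity, gmqEtaOne, gmqEtaTwo]
  rw [show ((d : ℝ) - (α - 2)) / 2 - (d : ℝ) / 2 = 1 - α / 2 by ring,
    show ((d : ℝ) - -α) / 2 - (d : ℝ) / 2 = α / 2 by ring,
    show ((d : ℝ) - (-α - 2)) / 2 - (d : ℝ) / 2 = α / 2 + 1 by ring,
    show ((d : ℝ) - (α - 2)) / 2 = (d : ℝ) / 2 - α / 2 + 1 by ring,
    show ((d : ℝ) - -α) / 2 = (d : ℝ) / 2 + α / 2 by ring,
    show ((d : ℝ) - (-α - 2)) / 2 = (d : ℝ) / 2 + α / 2 + 1 by ring,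
    macdonaldIntegral_add_one _ hc, macdonaldIntegral_symm (1 - α / 2) hc,
    show -(1 - α / 2) = α / 2 - 1 by ring]
  have h1 : (2 * Real.pi * ‖w‖) ^ α =
      2 ^ α * (Real.pi ^ 2 * ‖w‖ ^ 2) ^ (α / 2) := by
    rw [show Real.pi ^ 2 * ‖w‖ ^ 2 = (Real.pi * ‖w‖) ^ (2 : ℝ) by
        rw [Real.rpow_two, mul_pow],
      ← Real.rpow_mul (by positivity), mul_assoc, Real.mul_rpow (by positivity) (by positivity)]
    ring_nf
  have h2 : (Real.pi ^ 2 * ‖w‖ ^ 2) ^ (α / 2) * (Real.pi ^ 2 * ‖w‖ ^ 2) ^ (1 - α / 2) =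
      Real.pi ^ 2 * ‖w‖ ^ 2 := by
    rw [← Real.rpow_add hc]; simp
  have h3 : (2 : ℝ) ^ (α - 1) = 2 ^ α / 2 := Real.rpow_sub_one two_ne_zero α
  have hG1 : Real.Gamma ((d : ℝ) / 2 + α / 2) ≠ 0 :=
    (Real.Gamma_pos_of_pos (by linarith)).ne'
  have hG2 : Real.Gamma ((d : ℝ) / 2 + α / 2 + 1) ≠ 0 :=
    (Real.Gamma_pos_of_pos (by linarith)).ne'
  rw [h1, h3]
  set c := Real.pi ^ 2 * ‖w‖ ^ 2
  generalize Real.Gamma ((d : ℝ) / 2 - α / 2 + 1) = G at *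
  generalize Real.Gamma ((d : ℝ) / 2 + α / 2) = G1 at *
  generalize Real.Gamma ((d : ℝ) / 2 + α / 2 + 1) = G2 at *
  generalize macdonaldIntegral (α / 2 - 1) c = M at *
  generalize macdonaldIntegral (α / 2) c = N at *
  generalize Real.pi ^ ((d : ℝ) / 2) = P at *
  have e1 : -(α * (2 ^ α / 2) * G1 / G) * (P / G1 * N) = -(α * (2 ^ α / 2) / G * P * N) := by
    field_simp
  have e2 : 2 ^ α * G2 / G * (P / G2 * (α / 2 * N + c * M)) =
      2 ^ α / G * (P * (α / 2 * N + c * M)) := by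
    field_simp
  rw [e1, e2]
  linear_combination (2 ^ α * P / G * M) * h2

lemma ae_rpow_mul_besselDensity {d : ℕ} (hd : 1 ≤ d) {α : ℝ} (hα_lower : -(d : ℝ) < α) :
    (fun w : EuclideanSpace ℝ (Fin d) => gmqEtaOne d α * besselDensity d (((d : ℝ) - -α) / 2) w +
        gmqEtaTwo d α * besselDensity d (((d : ℝ) - (-α - 2)) / 2) w) =ᵐ[volume]
      fun w => (2 * Real.pi * ‖w‖) ^ α * besselDensity d (((d : ℝ) - (α - 2)) / 2) w := by
  have : Nonempty (Fin d) := ⟨⟨0, hd⟩⟩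
  filter_upwards [Measure.ae_ne volume 0] with w hw
  exact (rpow_mul_besselDensity hα_lower hw).symm

lemma hasFourierFracLaplacian_gmq {d : ℕ} (hd : 1 ≤ d) {α : ℝ} (hα_lower : -(d : ℝ) < α)
    (hα_upper : α < (d : ℝ) + 2) :
    HasFourierFracLaplacian α (gmq d (α - 2))
      (fun x => gmqEtaOne d α * gmq d (-α) x + gmqEtaTwo d α * gmq d (-α - 2) x) := by
  refine ⟨_, hasTemperedFourier_gmq d (by linarith), ?_⟩
  have h := (hasTemperedFourier_gmq d (β := -α) (by linarith)).const_mul_add_const_mul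
    (hasTemperedFourier_gmq d (β := -α - 2) (by linarith)) (gmqEtaOne d α) (gmqEtaTwo d α)
  have h2 := h.congr_ae (g' := fun w => (((2 * Real.pi * ‖w‖) ^ α : ℝ) : ℂ) *
    (besselDensity d (((d : ℝ) - (α - 2)) / 2) w : ℂ)) (by
      filter_upwards [ae_rpow_mul_besselDensity hd hα_lower] with w hw
      exact_mod_cast congrArg (fun r : ℝ => (r : ℂ)) hw)
  convert! h2 using 3
  push_cast
  rfl

/-! ### The symbol of the singular integral -/

lemma integrable_exp_neg_mul_sq_norm (d : ℕ) {t : ℝ} (ht : 0 < t) :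
    Integrable fun h : EuclideanSpace ℝ (Fin d) => Real.exp (-(‖h‖ ^ 2 * t)) := by
  have hb : 0 < ((t : ℝ) : ℂ).re := by rwa [Complex.ofReal_re]
  have h := GaussianFourier.integrable_cexp_neg_mul_sq_norm_add hb 0
    (0 : EuclideanSpace ℝ (Fin d))
  refine h.re.congr (Eventually.of_forall fun w => ?_)
  simp only [zero_mul, add_zero]
  rw [← Complex.ofReal_pow, ← Complex.ofReal_neg, ← Complex.ofReal_mul, ← Complex.ofReal_exp,
    RCLike.re_eq_complex_re, Complex.ofReal_re]
  ring_nf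

lemma integral_exp_neg_mul_one_sub_cos (d : ℕ) {t : ℝ} (ht : 0 < t)
    (w : EuclideanSpace ℝ (Fin d)) :
    ∫ h : EuclideanSpace ℝ (Fin d),
        Real.exp (-(‖h‖ ^ 2 * t)) * (1 - Real.cos (2 * Real.pi * inner ℝ w h)) =
      (Real.pi / t) ^ ((d : ℝ) / 2) * (1 - Real.exp (-(Real.pi ^ 2 * ‖w‖ ^ 2 / t))) := by
  have hpi := Real.pi_pos
  have hb : 0 < ((t : ℝ) : ℂ).re := by rwa [Complex.ofReal_re]
  have hI := GaussianFourier.integrable_cexp_neg_mul_sq_norm_add hb (2 * Real.pi * Complex.I) w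
  have hV := GaussianFourier.integral_cexp_neg_mul_sq_norm_add hb (2 * Real.pi * Complex.I) w
  have hre : ∀ h : EuclideanSpace ℝ (Fin d), RCLike.re (Complex.exp (-(t : ℂ) * ‖h‖ ^ 2 +
      2 * Real.pi * Complex.I * (inner ℝ w h : ℝ))) =
      Real.exp (-(‖h‖ ^ 2 * t)) * Real.cos (2 * Real.pi * inner ℝ w h) := by
    intro h
    have e : -(t : ℂ) * ‖h‖ ^ 2 + 2 * Real.pi * Complex.I * (inner ℝ w h : ℝ) =
      ((-(‖h‖ ^ 2 * t) : ℝ) : ℂ) + ((2 * Real.pi * inner ℝ w h : ℝ) : ℂ) * Complex.I := by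
      push_cast; ring
    rw [e, Complex.exp_add, ← Complex.ofReal_exp, RCLike.re_eq_complex_re, Complex.re_ofReal_mul,
      Complex.exp_ofReal_mul_I_re]
  have hIc : Integrable fun h : EuclideanSpace ℝ (Fin d) =>
      Real.exp (-(‖h‖ ^ 2 * t)) * Real.cos (2 * Real.pi * inner ℝ w h) :=
    hI.re.congr (Eventually.of_forall hre)
  have e2 : ((Real.pi : ℂ) / (t : ℂ)) ^ ((d : ℂ) / 2) *
      Complex.exp ((2 * Real.pi * Complex.I) ^ 2 * (‖w‖ : ℂ) ^ 2 / (4 * (t : ℂ))) =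
      (((Real.pi / t) ^ ((d : ℝ) / 2) * Real.exp (-(Real.pi ^ 2 * ‖w‖ ^ 2 / t)) : ℝ) : ℂ) := by
    rw [Complex.ofReal_mul, Complex.ofReal_cpow (by positivity), Complex.ofReal_exp]
    push_cast
    congr 2
    have : (t : ℂ) ≠ 0 := by exact_mod_cast ht.ne'
    field_simp
    rw [Complex.I_sq]
    ring
  rw [finrank_euclideanSpace_fin, e2] at hV
  have hVc := congrArg Complex.re hV
  rw [Complex.ofReal_re, ← RCLike.re_eq_complex_re, ← integral_re hI] at hVc
  simp_rw [hre] at hVc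
  have hV1 : ∫ h : EuclideanSpace ℝ (Fin d), Real.exp (-(‖h‖ ^ 2 * t)) =
      (Real.pi / t) ^ ((d : ℝ) / 2) := by
    have := GaussianFourier.integral_rexp_neg_mul_sq_norm (V := EuclideanSpace ℝ (Fin d)) ht
    rw [finrank_euclideanSpace_fin] at this
    rw [← this]
    simp only [neg_mul, mul_comm]
  simp_rw [mul_sub, mul_one]
  rw [integral_sub (integrable_exp_neg_mul_sq_norm d ht) hIc, hVc, hV1]

/-- The singular kernel has symbol `|ω|^α` with `ω = 2πw`: write `|h|^{-(d+α)}` as a Gamma mixture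
of the Gaussians `e^{-t|h|²}`, integrate in `h` first, and what is left is the integral of
`t^{α/2-1} (1 - e^{-π²|w|²/t})`. -/
lemma integrable_integral_one_sub_cos_div {d : ℕ} {α : ℝ} (hα0 : 0 < α) (hα2 : α < 2)
    {w : EuclideanSpace ℝ (Fin d)} (hw : w ≠ 0) :
    Integrable (fun h : EuclideanSpace ℝ (Fin d) =>
      (1 - Real.cos (2 * Real.pi * inner ℝ w h)) / ‖h‖ ^ ((d : ℝ) + α)) ∧
    fracLaplacianConst d α * ∫ h : EuclideanSpace ℝ (Fin d),
      (1 - Real.cos (2 * Real.pi * inner ℝ w h)) / ‖h‖ ^ ((d : ℝ) + α) =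
        (2 * Real.pi * ‖w‖) ^ α := by
  have hpi := Real.pi_pos
  have hw' : 0 < ‖w‖ := norm_pos_iff.2 hw
  have hc : 0 < Real.pi ^ 2 * ‖w‖ ^ 2 := by positivity
  set q : ℝ := ((d : ℝ) + α) / 2 with hq
  have hq0 : 0 < q := by positivity
  have hG : 0 < Real.Gamma q := Real.Gamma_pos_of_pos hq0
  set P : ℝ → EuclideanSpace ℝ (Fin d) → ℝ := fun t h => t ^ (q - 1) *
    (Real.exp (-(‖h‖ ^ 2 * t)) * (1 - Real.cos (2 * Real.pi * inner ℝ w h))) with hP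
  have hcos : ∀ θ : ℝ, 0 ≤ 1 - Real.cos θ := fun θ => sub_nonneg.2 (Real.cos_le_one θ)
  have hPnn : ∀ t ∈ Set.Ioi (0 : ℝ), ∀ h, 0 ≤ P t h := fun t ht h => by
    have ht : 0 < t := ht
    have := hcos (2 * Real.pi * inner ℝ w h)
    simp only [hP]
    positivity
  obtain ⟨hI, hV⟩ := integrableOn_integral_rpow_mul_one_sub_exp (a := α / 2) (by linarith)
    (by linarith) hc
  have hPh : ∀ t ∈ Set.Ioi (0 : ℝ), ∫ h, P t h = Real.pi ^ ((d : ℝ) / 2) *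
      (t ^ (α / 2 - 1) * (1 - Real.exp (-(Real.pi ^ 2 * ‖w‖ ^ 2 / t)))) := by
    intro t ht
    have ht : 0 < t := ht
    simp only [hP]
    rw [integral_const_mul, integral_exp_neg_mul_one_sub_cos d ht, Real.div_rpow hpi.le ht.le]
    have : t ^ (α / 2 - 1) = t ^ (q - 1) / t ^ ((d : ℝ) / 2) := by
      rw [← Real.rpow_sub ht, hq]; ring_nf
    rw [this]
    ring
  have hPI : Integrable (Function.uncurry P) ((volume.restrict (Set.Ioi 0)).prod volume) := by
    have hm : AEStronglyMeasurable (Function.uncurry P)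
        ((volume.restrict (Set.Ioi 0)).prod volume) := by
      simp only [hP]
      unfold Function.uncurry
      fun_prop
    rw [integrable_prod_iff hm]
    constructor
    · have hmc : AEStronglyMeasurable (fun h : EuclideanSpace ℝ (Fin d) =>
          1 - Real.cos (2 * Real.pi * inner ℝ w h)) volume := by fun_prop
      filter_upwards [ae_restrict_mem measurableSet_Ioi] with t ht
      refine ((integrable_exp_neg_mul_sq_norm d ht).mul_bdd (c := 2) hmc
        (Eventually.of_forall fun h => ?_)).const_mul (t ^ (q - 1))
      rw [Real.norm_of_nonneg (hcos _)]
      linarith [Real.neg_one_le_cos (2 * Real.pi * inner ℝ w h)]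
    · refine (hI.const_mul (Real.pi ^ ((d : ℝ) / 2))).congr ?_
      filter_upwards [ae_restrict_mem measurableSet_Ioi] with t ht
      rw [← hPh t ht]
      exact integral_congr_ae (Eventually.of_forall fun h =>
        (Real.norm_of_nonneg (hPnn t ht h)).symm)
  have hPt : ∀ h : EuclideanSpace ℝ (Fin d), ∫ t in Set.Ioi (0 : ℝ), P t h =
      Real.Gamma q * ((1 - Real.cos (2 * Real.pi * inner ℝ w h)) / ‖h‖ ^ ((d : ℝ) + α)) := by
    intro h
    -- At `h = 0` both sides vanish through the factor `1 - cos`.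
    rcases eq_or_ne h 0 with rfl | hh
    · simp [hP]
    have hh' : 0 < ‖h‖ := norm_pos_iff.2 hh
    simp only [hP, ← mul_assoc]
    rw [integral_mul_const, Real.integral_rpow_mul_exp_neg_mul_Ioi hq0 (by positivity), one_div,
      Real.inv_rpow (by positivity), ← Real.rpow_natCast, ← Real.rpow_mul hh'.le,
      show ((2 : ℕ) : ℝ) * q = (d : ℝ) + α by rw [hq]; push_cast; ring]
    ring
  have hswap := integral_integral_swap hPI
  have hPr := hPI.integral_prod_right
  simp only [Function.uncurry, hPt] at hPr
  simp_rw [hPt] at hswap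
  rw [setIntegral_congr_fun measurableSet_Ioi hPh, integral_const_mul, integral_const_mul, hV]
    at hswap
  refine ⟨?_, ?_⟩
  · refine (hPr.const_mul (Real.Gamma q)⁻¹).congr (Eventually.of_forall fun h => ?_)
    simp only
    rw [inv_mul_cancel_left₀ hG.ne']
  · have hG1 : 0 < Real.Gamma (1 - α / 2) := Real.Gamma_pos_of_pos (by linarith)
    have hGn : |Real.Gamma (-α / 2)| = Real.Gamma (1 - α / 2) / (α / 2) := by
      have h := Real.Gamma_add_one (s := -α / 2) (by linarith)
      rw [show -α / 2 + 1 = 1 - α / 2 by ring] at h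
      have h2 : Real.Gamma (-α / 2) = -(Real.Gamma (1 - α / 2) / (α / 2)) := by
        rw [h]; field_simp
      rw [h2, abs_neg, abs_of_pos (by positivity)]
    have h1 : (Real.pi ^ 2 * ‖w‖ ^ 2) ^ (α / 2) = (Real.pi * ‖w‖) ^ α := by
      rw [← mul_pow, ← Real.rpow_natCast, ← Real.rpow_mul (by positivity)]
      congr 1; push_cast; ring
    have h3 : (2 * Real.pi * ‖w‖) ^ α = 2 ^ α * (Real.pi * ‖w‖) ^ α := by
      rw [mul_assoc, Real.mul_rpow (by positivity) (by positivity)]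
    rw [fracLaplacianConst, hGn, show (α + (d : ℝ)) / 2 = q by rw [hq]; ring, h3]
    rw [h1] at hswap
    have hpd : 0 < Real.pi ^ ((d : ℝ) / 2) := by positivity
    rw [div_mul_eq_mul_div, div_eq_iff (by positivity), mul_assoc (2 ^ α), ← hswap]
    ring

/-! ### The singular integral -/

lemma fracLaplacianConst_pos (d : ℕ) {α : ℝ} (hα0 : 0 < α) (hα2 : α < 2) :
    0 < fracLaplacianConst d α := by
  have hpi := Real.pi_pos
  have h1 : 0 < Real.Gamma ((α + d) / 2) := Real.Gamma_pos_of_pos (by positivity)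
  have h2 : Real.Gamma (-α / 2) ≠ 0 := by
    refine Real.Gamma_ne_zero fun m hm => ?_
    have hm2 : α = 2 * m := by linarith
    rcases Nat.eq_zero_or_pos m with rfl | hm'
    · simp at hm2; linarith
    · have : (1 : ℝ) ≤ m := by exact_mod_cast hm'
      linarith
  unfold fracLaplacianConst
  positivity

lemma gmq_second_difference_eq {d : ℕ} {α : ℝ} (hα_upper : α < (d : ℝ) + 2)
    (x h : EuclideanSpace ℝ (Fin d)) :
    2 * gmq d (α - 2) x - gmq d (α - 2) (x + h) - gmq d (α - 2) (x - h) =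
      ∫ w, 2 * (besselDensity d (((d : ℝ) - (α - 2)) / 2) w *
        Real.cos (2 * Real.pi * inner ℝ w x) * (1 - Real.cos (2 * Real.pi * inner ℝ w h))) := by
  have hs : 0 < ((d : ℝ) - (α - 2)) / 2 := by linarith
  have hI : ∀ y : EuclideanSpace ℝ (Fin d), Integrable (fun w =>
      besselDensity d (((d : ℝ) - (α - 2)) / 2) w * Real.cos (2 * Real.pi * inner ℝ w y)) :=
    fun y => (integrable_besselDensity d hs).mul_bdd (c := 1) (by fun_prop)
      (Eventually.of_forall fun w => Real.abs_cos_le_one _)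
  simp_rw [gmq_eq_rpow, ← integral_besselDensity_mul_cos d hs]
  have hI2 : Integrable (fun w => 2 * (besselDensity d (((d : ℝ) - (α - 2)) / 2) w *
      Real.cos (2 * Real.pi * inner ℝ w x)) - besselDensity d (((d : ℝ) - (α - 2)) / 2) w *
      Real.cos (2 * Real.pi * inner ℝ w (x + h))) := ((hI x).const_mul 2).sub (hI _)
  rw [← integral_const_mul, ← integral_sub ((hI x).const_mul 2) (hI _), ← integral_sub hI2 (hI _)]
  refine integral_congr_ae (Eventually.of_forall fun w => ?_)
  simp only [inner_add_right, inner_sub_right, mul_add, mul_sub, Real.cos_add, Real.cos_sub]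
  ring

/-- Fubini: the symmetrized singular integral of the inversion formula for `gmq d (α - 2)` is the
inversion formula with the symbol `|ω|^α` inserted. -/
lemma integrable_integral_second_difference {d : ℕ} (hd : 1 ≤ d) {α : ℝ} (hα0 : 0 < α)
    (hα2 : α < 2) (x : EuclideanSpace ℝ (Fin d)) :
    Integrable (fun h : EuclideanSpace ℝ (Fin d) =>
      (2 * gmq d (α - 2) x - gmq d (α - 2) (x + h) - gmq d (α - 2) (x - h)) /
        ‖h‖ ^ ((d : ℝ) + α)) ∧
    fracLaplacianConst d α * ∫ h : EuclideanSpace ℝ (Fin d),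
      (2 * gmq d (α - 2) x - gmq d (α - 2) (x + h) - gmq d (α - 2) (x - h)) /
        ‖h‖ ^ ((d : ℝ) + α) =
      2 * (gmqEtaOne d α * gmq d (-α) x + gmqEtaTwo d α * gmq d (-α - 2) x) := by
  have : Nonempty (Fin d) := ⟨⟨0, hd⟩⟩
  have hd0 : (0 : ℝ) ≤ d := Nat.cast_nonneg d
  have hs : 0 < ((d : ℝ) - (α - 2)) / 2 := by linarith
  have hs1 : 0 < ((d : ℝ) - -α) / 2 := by linarith
  have hs2 : 0 < ((d : ℝ) - (-α - 2)) / 2 := by linarith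
  have hC := fracLaplacianConst_pos d hα0 hα2
  set C := fracLaplacianConst d α with hCdef
  set g := besselDensity d (((d : ℝ) - (α - 2)) / 2) with hg
  have hgI : Integrable g := integrable_besselDensity d hs
  have hsym : Integrable fun w => (2 * Real.pi * ‖w‖) ^ α * g w :=
    (((integrable_besselDensity d hs1).const_mul (gmqEtaOne d α)).add
      ((integrable_besselDensity d hs2).const_mul (gmqEtaTwo d α))).congr
      (ae_rpow_mul_besselDensity hd (by linarith))
  set F : EuclideanSpace ℝ (Fin d) → EuclideanSpace ℝ (Fin d) → ℝ := fun w h =>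
    2 * (g w * Real.cos (2 * Real.pi * inner ℝ w x)) *
      ((1 - Real.cos (2 * Real.pi * inner ℝ w h)) / ‖h‖ ^ ((d : ℝ) + α)) with hF
  have hFm : AEStronglyMeasurable (Function.uncurry F) (volume.prod volume) := by
    have h1 : AEStronglyMeasurable (fun z : EuclideanSpace ℝ (Fin d) × EuclideanSpace ℝ (Fin d) =>
        g z.1) (volume.prod volume) := hgI.aestronglyMeasurable.comp_fst
    have h2 : AEStronglyMeasurable (fun z : EuclideanSpace ℝ (Fin d) × EuclideanSpace ℝ (Fin d) =>
        Real.cos (2 * Real.pi * inner ℝ z.1 x)) (volume.prod volume) := by fun_prop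
    have h3 : AEStronglyMeasurable (fun z : EuclideanSpace ℝ (Fin d) × EuclideanSpace ℝ (Fin d) =>
        (1 - Real.cos (2 * Real.pi * inner ℝ z.1 z.2)) / ‖z.2‖ ^ ((d : ℝ) + α))
        (volume.prod volume) := by
      have : Measurable (fun z : EuclideanSpace ℝ (Fin d) × EuclideanSpace ℝ (Fin d) =>
        (1 - Real.cos (2 * Real.pi * inner ℝ z.1 z.2)) / ‖z.2‖ ^ ((d : ℝ) + α)) := by fun_prop
      exact this.aestronglyMeasurable
    exact ((h1.mul h2).const_mul 2).mul h3
  have hFI : Integrable (Function.uncurry F) (volume.prod volume) := by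
    rw [integrable_prod_iff hFm]
    constructor
    · filter_upwards [Measure.ae_ne volume 0] with w hw
      exact (integrable_integral_one_sub_cos_div hα0 hα2 hw).1.const_mul
        (2 * (g w * Real.cos (2 * Real.pi * inner ℝ w x)))
    · have hdom : Integrable fun w : EuclideanSpace ℝ (Fin d) =>
          2 / C * (|Real.cos (2 * Real.pi * inner ℝ w x)| *
            ((2 * Real.pi * ‖w‖) ^ α * g w)) :=
        (hsym.bdd_mul (c := 1) (by fun_prop) (Eventually.of_forall fun w => by
          rw [Real.norm_eq_abs, abs_abs]; exact Real.abs_cos_le_one _)).const_mul _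
      refine hdom.congr ?_
      filter_upwards [Measure.ae_ne volume 0] with w hw
      have hnn : ∀ h : EuclideanSpace ℝ (Fin d),
          0 ≤ (1 - Real.cos (2 * Real.pi * inner ℝ w h)) / ‖h‖ ^ ((d : ℝ) + α) := fun h =>
        div_nonneg (sub_nonneg.2 (Real.cos_le_one _)) (by positivity)
      have hg0 : 0 ≤ g w := besselDensity_nonneg d hs w
      simp only [Function.uncurry, hF, norm_mul, Real.norm_of_nonneg (hnn _),
        Real.norm_of_nonneg hg0, Real.norm_eq_abs, abs_two]
      rw [integral_const_mul, ← (integrable_integral_one_sub_cos_div hα0 hα2 hw).2, ← hCdef]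
      field_simp
  have hFh : ∀ h : EuclideanSpace ℝ (Fin d), ∫ w, F w h =
      (2 * gmq d (α - 2) x - gmq d (α - 2) (x + h) - gmq d (α - 2) (x - h)) /
        ‖h‖ ^ ((d : ℝ) + α) := by
    intro h
    rw [gmq_second_difference_eq (by linarith), ← integral_div]
    refine integral_congr_ae (Eventually.of_forall fun w => ?_)
    simp only [hF, hg]
    ring
  have hswap := integral_integral_swap hFI
  have hr := hFI.integral_prod_right
  simp only [Function.uncurry, hFh] at hr
  simp_rw [hFh] at hswap
  refine ⟨hr, ?_⟩
  have hIc : ∀ s : ℝ, 0 < s → Integrable (fun w : EuclideanSpace ℝ (Fin d) =>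
      besselDensity d s w * Real.cos (2 * Real.pi * inner ℝ w x)) :=
    fun s hs => (integrable_besselDensity d hs).mul_bdd (c := 1) (by fun_prop)
      (Eventually.of_forall fun w => Real.abs_cos_le_one _)
  rw [← hswap, ← integral_const_mul, gmq_eq_rpow, gmq_eq_rpow,
    ← integral_besselDensity_mul_cos d hs1, ← integral_besselDensity_mul_cos d hs2,
    ← integral_const_mul, ← integral_const_mul, ← integral_add
      ((hIc _ hs1).const_mul _) ((hIc _ hs2).const_mul _), ← integral_const_mul]
  refine integral_congr_ae ?_
  filter_upwards [Measure.ae_ne volume 0, ae_rpow_mul_besselDensity (α := α) hd (by linarith)]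
    with w hw hw2
  simp only [hF]
  rw [integral_const_mul]
  linear_combination 2 * Real.cos (2 * Real.pi * inner ℝ w x) * g w *
    (integrable_integral_one_sub_cos_div hα0 hα2 hw).2 -
    2 * Real.cos (2 * Real.pi * inner ℝ w x) * hw2

lemma integrableOn_norm_rpow_of_lt_norm {d : ℕ} (hd : 1 ≤ d) {q ε : ℝ} (hq : q < -(d : ℝ))
    (hε : 0 < ε) :
    IntegrableOn (fun h : EuclideanSpace ℝ (Fin d) => ‖h‖ ^ q) {h | ε < ‖h‖} := by
  have : Nonempty (Fin d) := ⟨⟨0, hd⟩⟩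
  have hS : MeasurableSet {h : EuclideanSpace ℝ (Fin d) | ε < ‖h‖} :=
    measurableSet_lt measurable_const measurable_norm
  rw [← integrable_indicator_iff hS]
  refine (integrable_fun_norm_addHaar (E := EuclideanSpace ℝ (Fin d)) volume
    (f := (Set.Ioi ε).indicator fun r => r ^ q)).2 ?_
  rw [finrank_euclideanSpace_fin]
  have h1 : IntegrableOn (fun r : ℝ => r ^ (d - 1 + q : ℝ)) (Set.Ioi ε) :=
    integrableOn_Ioi_rpow_of_lt (by linarith) hε
  refine ((integrable_indicator_iff measurableSet_Ioi).2 h1).integrableOn.congr_fun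
    (fun r hr => ?_) measurableSet_Ioi
  have hr : 0 < r := hr
  by_cases h : r ∈ Set.Ioi ε
  · simp only [Set.indicator_of_mem h, smul_eq_mul]
    rw [Real.rpow_add hr, ← Nat.cast_pred hd, Real.rpow_natCast]
  · simp [Set.indicator_of_notMem h]

lemma integrableOn_norm_rpow_of_norm_le {d : ℕ} (hd : 1 ≤ d) {q : ℝ} (hq : -(d : ℝ) < q) :
    IntegrableOn (fun h : EuclideanSpace ℝ (Fin d) => ‖h‖ ^ q) {h | ‖h‖ ≤ 1} := by
  have : Nonempty (Fin d) := ⟨⟨0, hd⟩⟩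
  have hS : MeasurableSet {h : EuclideanSpace ℝ (Fin d) | ‖h‖ ≤ 1} :=
    measurableSet_le measurable_norm measurable_const
  rw [← integrable_indicator_iff hS]
  refine (integrable_fun_norm_addHaar (E := EuclideanSpace ℝ (Fin d)) volume
    (f := (Set.Iic 1).indicator fun r => r ^ q)).2 ?_
  rw [finrank_euclideanSpace_fin]
  have h1 : IntegrableOn (fun r : ℝ => r ^ (d - 1 + q : ℝ)) (Set.Ioc 0 1) :=
    (intervalIntegrable_iff_integrableOn_Ioc_of_le zero_le_one).1
      (intervalIntegral.intervalIntegrable_rpow' (by linarith))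
  refine ((integrable_indicator_iff measurableSet_Ioc).2 h1).integrableOn.congr_fun
    (fun r hr => ?_) measurableSet_Ioi
  have hr : 0 < r := hr
  by_cases h : r ≤ 1
  · simp only [Set.indicator_of_mem (Set.mem_Ioc.2 ⟨hr, h⟩),
      Set.indicator_of_mem (Set.mem_Iic.2 h), smul_eq_mul]
    rw [Real.rpow_add hr, ← Nat.cast_pred hd, Real.rpow_natCast]
  · simp [h]

lemma measurable_gmq (d : ℕ) (β : ℝ) : Measurable (gmq d β) := by
  unfold gmq
  fun_prop

lemma abs_gmq_sub_le_one {d : ℕ} {β : ℝ} (hβ : β ≤ d) (x y : EuclideanSpace ℝ (Fin d)) :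
    |gmq d β x - gmq d β y| ≤ 1 := by
  have h : ∀ z, 0 ≤ gmq d β z ∧ gmq d β z ≤ 1 := fun z => by
    unfold gmq
    exact ⟨by positivity, Real.rpow_le_one_of_one_le_of_nonpos
      (by linarith [sq_nonneg ‖z‖]) (by linarith)⟩
  rw [abs_le]
  constructor <;> linarith [(h x).1, (h x).2, (h y).1, (h y).2]

lemma abs_gmq_sub_le_mul_norm {d : ℕ} {β : ℝ} (hβ : β ≤ d) (x y : EuclideanSpace ℝ (Fin d)) :
    |gmq d β x - gmq d β y| ≤ (d - β) * ‖x - y‖ := by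
  have hderiv : ∀ r : ℝ, HasDerivAt (fun r : ℝ => (1 + r ^ 2) ^ (β / 2 - (d : ℝ) / 2))
      (2 * r * (β / 2 - (d : ℝ) / 2) * (1 + r ^ 2) ^ (β / 2 - (d : ℝ) / 2 - 1)) r := by
    intro r
    have h1 : HasDerivAt (fun r : ℝ => 1 + r ^ 2) (2 * r) r := by
      simpa using ((hasDerivAt_id r).pow 2).const_add 1
    exact h1.rpow_const (Or.inl (by positivity))
  have hbound : ∀ r : ℝ, ‖2 * r * (β / 2 - (d : ℝ) / 2) *
      (1 + r ^ 2) ^ (β / 2 - (d : ℝ) / 2 - 1)‖ ≤ d - β := by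
    intro r
    have h1 : (1 : ℝ) ≤ 1 + r ^ 2 := by linarith [sq_nonneg r]
    have h2 : (1 + r ^ 2) ^ (β / 2 - (d : ℝ) / 2 - 1) ≤ (1 + r ^ 2)⁻¹ := by
      rw [← Real.rpow_neg_one]
      exact Real.rpow_le_rpow_of_exponent_le h1 (by linarith)
    have h3 : |r| ≤ 1 + r ^ 2 := by
      rw [← sq_abs]
      nlinarith [sq_nonneg (|r| - 1), abs_nonneg r]
    have h4 : |β / 2 - (d : ℝ) / 2| = (d - β) / 2 := by
      rw [abs_of_nonpos (by linarith)]; ring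
    rw [norm_mul, norm_mul, norm_mul, Real.norm_eq_abs, Real.norm_eq_abs, Real.norm_eq_abs,
      Real.norm_of_nonneg (by positivity), h4, abs_two]
    calc 2 * |r| * ((d - β) / 2) * (1 + r ^ 2) ^ (β / 2 - (d : ℝ) / 2 - 1)
        ≤ 2 * (1 + r ^ 2) * ((d - β) / 2) * (1 + r ^ 2)⁻¹ := by
          have : 0 ≤ (d - β) / 2 := by linarith
          gcongr
      _ = d - β := by
          field_simp
  have h := convex_univ.norm_image_sub_le_of_norm_hasDerivWithin_le
    (fun r _ => (hderiv r).hasDerivWithinAt) (fun r _ => hbound r)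
    (Set.mem_univ ‖y‖) (Set.mem_univ ‖x‖)
  refine h.trans ?_
  have : (0 : ℝ) ≤ d - β := by linarith
  gcongr
  exact abs_norm_sub_norm_le x y

lemma integrableOn_gmq_sub_div {d : ℕ} (hd : 1 ≤ d) {α β ε : ℝ} (hα0 : 0 < α) (hβ : β ≤ d)
    (x : EuclideanSpace ℝ (Fin d)) (hε : 0 < ε) :
    IntegrableOn (fun h => (gmq d β x - gmq d β (x - h)) / ‖h‖ ^ ((d : ℝ) + α))
      {h | ε < ‖h‖} := by
  have hm : Measurable (fun h => (gmq d β x - gmq d β (x - h)) / ‖h‖ ^ ((d : ℝ) + α)) := by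
    have := measurable_gmq d β
    fun_prop
  refine Integrable.mono' (integrableOn_norm_rpow_of_lt_norm hd (q := -((d : ℝ) + α))
    (by linarith) hε) hm.aestronglyMeasurable (Eventually.of_forall fun h => ?_)
  rw [norm_div, Real.norm_eq_abs, Real.norm_of_nonneg (by positivity),
    Real.rpow_neg (norm_nonneg h), div_eq_mul_inv]
  exact mul_le_of_le_one_left (by positivity) (abs_gmq_sub_le_one hβ _ _)

lemma integrable_gmq_sub_div {d : ℕ} (hd : 1 ≤ d) {α β : ℝ} (hα0 : 0 < α) (hα1 : α < 1)
    (hβ : β ≤ d) (x : EuclideanSpace ℝ (Fin d)) :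
    Integrable (fun h => (gmq d β x - gmq d β (x - h)) / ‖h‖ ^ ((d : ℝ) + α)) := by
  have hm : Measurable (fun h => (gmq d β x - gmq d β (x - h)) / ‖h‖ ^ ((d : ℝ) + α)) := by
    have := measurable_gmq d β
    fun_prop
  have hU : {h : EuclideanSpace ℝ (Fin d) | ‖h‖ ≤ 1} ∪ {h | 1 < ‖h‖} = Set.univ := by
    ext h
    simpa using le_or_gt ‖h‖ 1
  rw [← integrableOn_univ, ← hU]
  refine IntegrableOn.union ?_ (integrableOn_gmq_sub_div hd hα0 hβ x one_pos)
  refine Integrable.mono' ((integrableOn_norm_rpow_of_norm_le hd (q := 1 - ((d : ℝ) + α))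
    (by linarith)).const_mul (d - β)) hm.aestronglyMeasurable (Eventually.of_forall fun h => ?_)
  rcases eq_or_ne h 0 with rfl | hh
  · have : (0 : ℝ) ≤ d - β := by linarith
    simp only [sub_zero, sub_self, zero_div, norm_zero]
    positivity
  have hh' : 0 < ‖h‖ := norm_pos_iff.2 hh
  have h1 := abs_gmq_sub_le_mul_norm hβ x (x - h)
  rw [sub_sub_cancel] at h1
  rw [norm_div, Real.norm_eq_abs, Real.norm_of_nonneg (by positivity), Real.rpow_sub hh',
    Real.rpow_one, ← mul_div_assoc]
  gcongr

/-- Averaging an integral over a symmetric set with its reflection turns first differences into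
second differences. -/
lemma setIntegral_gmq_sub_div_eq {d : ℕ} {α β : ℝ} (x : EuclideanSpace ℝ (Fin d))
    {T : Set (EuclideanSpace ℝ (Fin d))} (hT : MeasurableSet T) (hneg : ∀ h, -h ∈ T ↔ h ∈ T)
    (hI : IntegrableOn (fun h => (gmq d β x - gmq d β (x - h)) / ‖h‖ ^ ((d : ℝ) + α)) T) :
    2 * ∫ h in T, (gmq d β x - gmq d β (x - h)) / ‖h‖ ^ ((d : ℝ) + α) =
      ∫ h in T, (2 * gmq d β x - gmq d β (x + h) - gmq d β (x - h)) / ‖h‖ ^ ((d : ℝ) + α) := by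
  set f : EuclideanSpace ℝ (Fin d) → ℝ :=
    fun h => (gmq d β x - gmq d β (x - h)) / ‖h‖ ^ ((d : ℝ) + α) with hf
  have hind : ∀ h, T.indicator f (-h) = T.indicator (fun h => f (-h)) h := fun h => by
    by_cases hh : h ∈ T
    · rw [Set.indicator_of_mem hh, Set.indicator_of_mem ((hneg h).2 hh)]
    · rw [Set.indicator_of_notMem hh, Set.indicator_of_notMem (mt (hneg h).1 hh)]
  have hI' : IntegrableOn (fun h => f (-h)) T := by
    rw [← integrable_indicator_iff hT] at hI ⊢
    exact hI.comp_neg.congr (Eventually.of_forall hind)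
  have hrefl : ∫ h in T, f (-h) = ∫ h in T, f h := by
    rw [← integral_indicator hT, ← integral_indicator hT,
      ← integral_neg_eq_self (T.indicator f) volume]
    exact integral_congr_ae (Eventually.of_forall fun h => (hind h).symm)
  have hsum : ∀ h, (2 * gmq d β x - gmq d β (x + h) - gmq d β (x - h)) / ‖h‖ ^ ((d : ℝ) + α) =
      f h + f (-h) := fun h => by
    simp only [hf, norm_neg, sub_neg_eq_add]
    ring
  simp_rw [hsum]
  rw [integral_add hI hI', hrefl]
  ring

lemma hasIntegralFracLaplacianAt_gmq {d : ℕ} (hd : 1 ≤ d) {α : ℝ} (hα0 : 0 < α) (hα2 : α < 2)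
    (x : EuclideanSpace ℝ (Fin d)) :
    HasIntegralFracLaplacianAt α (gmq d (α - 2))
      (gmqEtaOne d α * gmq d (-α) x + gmqEtaTwo d α * gmq d (-α - 2) x) x := by
  have hβ : α - 2 ≤ d := by
    have : (0 : ℝ) ≤ d := Nat.cast_nonneg d
    linarith
  obtain ⟨hKI, hKV⟩ := integrable_integral_second_difference hd hα0 hα2 x
  set K : EuclideanSpace ℝ (Fin d) → ℝ := fun h =>
    (2 * gmq d (α - 2) x - gmq d (α - 2) (x + h) - gmq d (α - 2) (x - h)) / ‖h‖ ^ ((d : ℝ) + α)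
    with hK
  set f : EuclideanSpace ℝ (Fin d) → ℝ :=
    fun h => (gmq d (α - 2) x - gmq d (α - 2) (x - h)) / ‖h‖ ^ ((d : ℝ) + α) with hf
  have hfe : ∀ y, fracLaplacianIntegrand α (gmq d (α - 2)) x y = f (x - y) :=
    fun y => by simp [fracLaplacianIntegrand, hf]
  simp only [HasIntegralFracLaplacianAt, hfe]
  constructor
  · intro hα1
    have hfI : Integrable f := integrable_gmq_sub_div hd hα0 hα1 hβ x
    refine ⟨hfI.comp_sub_left x, ?_⟩
    rw [integral_sub_left_eq_self f volume x]
    have h := setIntegral_gmq_sub_div_eq x MeasurableSet.univ (by simp) hfI.integrableOn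
    simp only [Measure.restrict_univ] at h
    rw [← h] at hKV
    linarith
  · intro _
    have hTm : ∀ ε : ℝ, MeasurableSet {h : EuclideanSpace ℝ (Fin d) | ε < ‖h‖} := fun ε =>
      measurableSet_lt measurable_const measurable_norm
    have hSm : ∀ ε : ℝ, MeasurableSet {y : EuclideanSpace ℝ (Fin d) | ε < ‖x - y‖} := fun ε =>
      measurableSet_lt measurable_const (by fun_prop)
    have hind : ∀ (ε : ℝ) (y : EuclideanSpace ℝ (Fin d)),
        {h : EuclideanSpace ℝ (Fin d) | ε < ‖h‖}.indicator f (x - y) =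
          {y : EuclideanSpace ℝ (Fin d) | ε < ‖x - y‖}.indicator (fun y => f (x - y)) y :=
      fun ε y => rfl
    have hfI : ∀ ε : ℝ, 0 < ε → IntegrableOn f {h | ε < ‖h‖} := fun ε hε =>
      integrableOn_gmq_sub_div hd hα0 hβ x hε
    refine ⟨fun ε hε => ?_, ?_⟩
    · rw [← integrable_indicator_iff (hSm ε)]
      exact ((integrable_indicator_iff (hTm ε)).2 (hfI ε hε)).comp_sub_left x
    have hlim : Tendsto (fun ε : ℝ => ∫ h in {h | ε < ‖h‖}, K h) (𝓝[>] 0) (𝓝 (∫ h, K h)) := by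
      simp_rw [← integral_indicator (hTm _)]
      refine tendsto_integral_filter_of_dominated_convergence (fun h => ‖K h‖)
        (Eventually.of_forall fun ε => hKI.aestronglyMeasurable.indicator (hTm ε))
        (Eventually.of_forall fun ε => Eventually.of_forall fun h => norm_indicator_le_norm_self _ _)
        hKI.norm (Eventually.of_forall fun h => ?_)
      refine tendsto_const_nhds.congr' ?_
      -- The point `h = 0` lies in no `{ε < |h|}`, but the second difference vanishes there.
      rcases eq_or_ne h 0 with rfl | hh
      · refine Eventually.of_forall fun ε => ?_
        have : K 0 = 0 := by simp only [hK, add_zero, sub_zero]; ring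
        simp [Set.indicator, this]
      · have : ∀ᶠ ε : ℝ in 𝓝[>] 0, ε < ‖h‖ :=
          nhdsWithin_le_nhds (eventually_lt_nhds (norm_pos_iff.2 hh))
        filter_upwards [this] with ε hε
        rw [Set.indicator_of_mem (by exact hε)]
    have hL : gmqEtaOne d α * gmq d (-α) x + gmqEtaTwo d α * gmq d (-α - 2) x =
        fracLaplacianConst d α * (1 / 2 * ∫ h, K h) := by linarith
    rw [hL]
    refine ((hlim.const_mul (1 / 2)).const_mul _).congr' ?_
    filter_upwards [self_mem_nhdsWithin] with ε hε
    have hS : ∫ y in {y | ε < ‖x - y‖}, f (x - y) = ∫ h in {h | ε < ‖h‖}, f h := by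
      rw [← integral_indicator (hSm ε), ← integral_indicator (hTm ε),
        ← integral_sub_left_eq_self (Set.indicator _ f) volume x]
      rfl
    rw [← setIntegral_gmq_sub_div_eq x (hTm ε) (by simp) (hfI ε hε), hS]
    ring

theorem mainTheorem3 (d : ℕ) (hd : 1 ≤ d) (α : ℝ) (hα_lower : -(d : ℝ) < α)
    (hα_upper : α < (d : ℝ) + 2) :
    HasFourierFracLaplacian α (gmq d (α - 2))
      (fun x => gmqEtaOne d α * gmq d (-α) x + gmqEtaTwo d α * gmq d (-α - 2) x) ∧
    (0 < α → α < 2 → ∀ x : EuclideanSpace ℝ (Fin d),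
      HasIntegralFracLaplacianAt α (gmq d (α - 2))
        (gmqEtaOne d α * gmq d (-α) x + gmqEtaTwo d α * gmq d (-α - 2) x) x) :=
  ⟨hasFourierFracLaplacian_gmq hd hα_lower hα_upper,
    fun hα0 hα2 x => hasIntegralFracLaplacianAt_gmq hd hα0 hα2 x⟩
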